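/- For a set $P\subset\mathbb{R}^d$ that is a $d$-dimensional lattice polytope (the convex hull of finitely many points of $\mathbb{Z}^d$, with affine hull $\mathbb{R}^d$), let $\mathrm{Ehr}_P(z)=\sum_{k\ge 0}\#(kP\cap\mathbb{Z}^d)\,z^k$ be its Ehrhart series. It can be written as $$\mathrm{Ehr}_P(z)=\frac{a_0(P)+a_1(P)z+\dots+a_d(P)z^d}{(1-z)^{d+1}};$$ the numerator is the $h^\star$-polynomial of $P$, and its degree is denoted by $\deg(P)$. With $e_i$ the $i$-th unit vector of $\mathbb{R}^d$ ($d\ge1$, $e_0=0$) and $m\ge 1$ an integer, put $$T^{(m)}_d=\mathrm{conv}\{0,e_1,e_1+e_2,\dots,e_{d-2}+e_{d-1},e_{d-1}+m\,e_d\},\qquad S^{(m)}_d=\mathrm{conv}\{0,e_1,\dots,e_{d-1},m\,e_d\}.$$ For $P\subset\mathbb{R}^p$ and $Q\subset\mathbb{R}^q$ let $P\star Q=\mathrm{conv}\{(x,0_q,0),(0_p,y,1): x\in P,\ y\in Q\}\subset\mathbb{R}^{p+q+1}$ be their join. Let $p,q\ge 1$ be integers with $q$ odd. (1) For all integers $l,m\ge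 0$ the join $T^{(l+1)}_q\star S^{(m+1)}_p$ is a $(p+q+1)$-dimensional lattice polytope, and $$\mathrm{Ehr}_{T^{(l+1)}_q\star S^{(m+1)}_p}(z)=\frac{1+m\,z+l\,z^{(q+1)/2}+m\,l\,z^{(q+3)/2}}{(1-z)^{p+q+2}}.$$ (2) If $q\ge 3$ and $1\le l<m$, then $T^{(l+1)}_q\star S^{(m+1)}_p$ is a $(p+q+1)$-dimensional lattice polytope without interior lattice points for which Hibi's lower bound $$a_i(P)\ge a_1(P),\qquad 1\le i\le\deg(P)-1,$$ fails, i.e. $a_i<a_1$ for some $i$ with $1\le i\le\deg-1$. -/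

import Mathlib

open scoped Pointwise

/-- The set of points of `ℝ^d` with integral coordinates. -/
def integerLattice (d : ℕ) : Set (Fin d → ℝ) :=
  {x | ∀ j, ∃ n : ℤ, x j = (n : ℝ)}

/-- `P` is a `d`-dimensional lattice polytope in `ℝ^d`: the convex hull of finitely many
lattice points, with affine hull the whole space. -/
def IsFullLatticePolytope {d : ℕ} (P : Set (Fin d → ℝ)) : Prop :=
  (∃ V : Finset (Fin d → ℝ), (V : Set (Fin d → ℝ)) ⊆ integerLattice d ∧
    P = convexHull ℝ (V : Set (Fin d → ℝ))) ∧
  affineSpan ℝ P = ⊤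

/-- The lattice point enumerator: the number of lattice points in `S` (used for bounded `S`). -/
noncomputable def latticePointCount {d : ℕ} (S : Set (Fin d → ℝ)) : ℕ :=
  (S ∩ integerLattice d).ncard

/-- The Ehrhart series of `P`: the formal power series whose `k`-th coefficient is the number of
lattice points of the dilate `k P`. For nonempty `P` one has `0 P = {0}`, so that the constant
coefficient is `1`, the value of the Ehrhart polynomial at `0`. -/
noncomputable def ehrhartSeries {d : ℕ} (P : Set (Fin d → ℝ)) : PowerSeries ℚ :=
  PowerSeries.mk fun k => (latticePointCount ((k : ℝ) • P) : ℚ)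

/-- `h` is the `h^*`-polynomial of `P ⊆ ℝ^d`: it has degree at most `d`, and the Ehrhart series
of `P` is `h(z) / (1 - z)^(d+1)`. There is at most one such `h`. -/
def IsHStarPolynomial {d : ℕ} (P : Set (Fin d → ℝ)) (h : Polynomial ℚ) : Prop :=
  h.natDegree ≤ d ∧
    ehrhartSeries P = (h : PowerSeries ℚ) * ((1 - PowerSeries.X) ^ (d + 1))⁻¹

/-- The inequalities `a_i(P) ≥ a_1(P)` for `1 ≤ i ≤ deg(P) - 1`, where the `a_i(P)` are the
coefficients and `deg(P)` is the degree of the `h^*`-polynomial of `P`. -/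
def HibiLowerBound {d : ℕ} (P : Set (Fin d → ℝ)) : Prop :=
  ∀ h : Polynomial ℚ, IsHStarPolynomial P h →
    ∀ i : ℕ, 1 ≤ i → i ≤ h.natDegree - 1 → h.coeff 1 ≤ h.coeff i

/-- The unit vector `e_i` of `ℝ^d`, for `1 ≤ i ≤ d`; moreover `e_0 = 0`. -/
def unitVec (d i : ℕ) : Fin d → ℝ :=
  fun j => if (j : ℕ) + 1 = i then 1 else 0

/-- `T_d^{(m)} = conv {0, e_1, e_1 + e_2, …, e_{d-2} + e_{d-1}, e_{d-1} + m e_d}`, for `d ≥ 1`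
(where `e_0 = 0`). -/
def simplexT (d m : ℕ) : Set (Fin d → ℝ) :=
  convexHull ℝ
    ({0} ∪ {x | ∃ i : ℕ, 1 ≤ i ∧ i < d ∧ x = unitVec d (i - 1) + unitVec d i} ∪
      {unitVec d (d - 1) + (m : ℝ) • unitVec d d})

/-- `S_d^{(m)} = conv {0, e_1, e_2, …, e_{d-1}, m e_d}`, for `d ≥ 1`. -/
def simplexS (d m : ℕ) : Set (Fin d → ℝ) :=
  convexHull ℝ
    ({0} ∪ {x | ∃ i : ℕ, 1 ≤ i ∧ i < d ∧ x = unitVec d i} ∪ {(m : ℝ) • unitVec d d})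

/-- The join `P ⋆ Q = conv {(x, 0, 0), (0, y, 1) : x ∈ P, y ∈ Q} ⊆ ℝ^(p+q+1)`. -/
def polytopeJoin {p q : ℕ} (P : Set (Fin p → ℝ)) (Q : Set (Fin q → ℝ)) :
    Set (Fin (p + q + 1) → ℝ) :=
  convexHull ℝ
    ({v | ∃ x ∈ P, v = Fin.snoc (α := fun _ => ℝ) (Fin.append x (0 : Fin q → ℝ)) 0} ∪
      {v | ∃ y ∈ Q, v = Fin.snoc (α := fun _ => ℝ) (Fin.append (0 : Fin p → ℝ) y) 1})

/-!
The join of `T = T_q^{(l+1)}` and `S = S_p^{(m+1)}` is a lattice simplex, and the Ehrhart series of a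
lattice simplex is read off from its half-open fundamental parallelepiped. Split the barycentric
coordinates of a lattice point of the dilate `k P` into integer and fractional parts: the fractional
parts are the coordinates of one of finitely many box points, of some height `h`, and the integer
parts are an arbitrary vector of natural numbers with sum `k - h`. Hence
`Ehr_P(z) = (∑ z^h) / (1 - z)^(d+1)`, the sum being over the box points. The notion is
`IsBoxSystem`, the formula is `IsBoxSystem.ehrhartSeries_eq`.

The last coordinate of a point of the join is the sum of its barycentric coordinates at the vertices
of the second factor. Therefore the box points of a join are the pairs of box points of the factors,
and heights add up (`IsBoxSystem.join`). For `T` and `S` the box points form a cyclic group,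
generated by the fractional parts of `ε / (l + 1)`, respectively `ε / (m + 1)`, for a vector `ε` with
entries in `{-1, 0, 1}` (`IsBoxSystem.of_cyclic`). For `S` only the first and the last vertex have a
nonzero entry, `-1` and `1`, so that nonzero box points have height `1`; for `T` the signs alternate,
and as `q` is odd the height is `(q + 1) / 2`. The numerator for the join is thus
`(1 + m z) (1 + l z^((q+1)/2))`.

A join lies between two adjacent lattice hyperplanes, which excludes interior lattice points. If
`q ≥ 3` and `1 ≤ l < m`, then the linear coefficient of the numerator is `m`, while the coefficient
just below the leading one is `l`.
-/

/-! ### Lattice points and box systems -/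

/-- The integers, as a subgroup of the real numbers. -/
abbrev integralReals : AddSubgroup ℝ := (Int.castAddHom ℝ).range

theorem mem_integralReals {x : ℝ} : x ∈ integralReals ↔ ∃ n : ℤ, x = n := by
  rw [AddMonoidHom.mem_range]
  exact exists_congr fun n => eq_comm

theorem intCast_mem_integralReals (n : ℤ) : (n : ℝ) ∈ integralReals :=
  mem_integralReals.2 ⟨n, rfl⟩

theorem natCast_mem_integralReals (n : ℕ) : (n : ℝ) ∈ integralReals :=
  mem_integralReals.2 ⟨n, by simp⟩

theorem mem_integerLattice_iff {d : ℕ} {x : Fin d → ℝ} :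
    x ∈ integerLattice d ↔ ∀ j, x j ∈ integralReals := by
  simp only [mem_integralReals]; rfl

/-- The arithmetic data of the lattice simplex with vertices `v i`, `i ∈ ι`. The points `b c`,
`c ∈ B`, are the barycentric coordinate vectors of the lattice points of the half-open
fundamental parallelepiped over the simplex: they lie in `[0, 1)^ι`, and they represent the classes
modulo `ℤ^ι` of all coordinate vectors `w` whose height `∑ i, w i` and value `∑ i, w i • v i` are
integral. The height of `b c` is `h c`. -/
structure IsBoxSystem {ι B : Type*} [Fintype ι] {d : ℕ} (v : ι → Fin d → ℝ) (b : B → ι → ℝ)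
    (h : B → ℕ) : Prop where
  card_eq : Fintype.card ι = d + 1
  vertex_mem : ∀ i, v i ∈ integerLattice d
  eq_zero : ∀ w : ι → ℝ, ∑ i, w i = 0 → ∑ i, w i • v i = 0 → w = 0
  nonneg : ∀ c i, 0 ≤ b c i
  lt_one : ∀ c i, b c i < 1
  injective : Function.Injective b
  sum_eq : ∀ c, ∑ i, b c i = h c
  integral_iff : ∀ w : ι → ℝ,
    (∑ i, w i ∈ integralReals ∧ ∑ i, w i • v i ∈ integerLattice d) ↔
      ∃ c, ∀ i, w i - b c i ∈ integralReals

/-! ### Ehrhart series of lattice simplices -/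

theorem mem_convexHull_range_iff {ι E : Type*} [Fintype ι] [AddCommGroup E] [Module ℝ E]
    {v : ι → E} {x : E} :
    x ∈ convexHull ℝ (Set.range v) ↔
      ∃ w : ι → ℝ, (∀ i, 0 ≤ w i) ∧ ∑ i, w i = 1 ∧ ∑ i, w i • v i = x := by
  classical
  constructor
  · intro hx
    rw [mem_convexHull_iff_exists_fintype] at hx
    obtain ⟨κ, _, w, z, hw, hw1, hz, rfl⟩ := hx
    choose f hf using hz
    refine ⟨fun i => ∑ k with f k = i, w k, fun i => Finset.sum_nonneg fun k _ => hw k, ?_, ?_⟩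
    · exact (Finset.sum_fiberwise Finset.univ f w).trans hw1
    · simp_rw [Finset.sum_smul]
      rw [← Finset.sum_fiberwise Finset.univ f (fun k => w k • z k)]
      refine Finset.sum_congr rfl fun i _ => Finset.sum_congr rfl fun k hk => ?_
      rw [← hf k, (Finset.mem_filter.1 hk).2]
  · rintro ⟨w, hw, hw1, rfl⟩
    exact (convex_convexHull ℝ _).sum_mem (fun i _ => hw i) hw1
      fun i _ => subset_convexHull ℝ _ ⟨i, rfl⟩

theorem mem_natCast_smul_convexHull_range_iff {ι E : Type*} [Fintype ι] [Nonempty ι]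
    [AddCommGroup E] [Module ℝ E] {v : ι → E} {x : E} (k : ℕ) :
    x ∈ (k : ℝ) • convexHull ℝ (Set.range v) ↔
      ∃ w : ι → ℝ, (∀ i, 0 ≤ w i) ∧ ∑ i, w i = k ∧ ∑ i, w i • v i = x := by
  classical
  constructor
  · rintro ⟨y, hy, rfl⟩
    obtain ⟨w, hw, hw1, rfl⟩ := mem_convexHull_range_iff.1 hy
    refine ⟨fun i => k * w i, fun i => mul_nonneg (Nat.cast_nonneg k) (hw i), ?_, ?_⟩
    · rw [← Finset.mul_sum, hw1, mul_one]
    · simp [Finset.smul_sum, mul_smul]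
  · rintro ⟨w, hw, hwk, rfl⟩
    rcases Nat.eq_zero_or_pos k with rfl | hk
    · have hw0 : ∀ i, w i = 0 := fun i =>
        (Finset.sum_eq_zero_iff_of_nonneg fun i _ => hw i).1 (by simpa using hwk) i
          (Finset.mem_univ i)
      refine ⟨v (Classical.arbitrary ι), subset_convexHull ℝ _ ⟨_, rfl⟩, ?_⟩
      simp [hw0]
    · have hk' : (k : ℝ) ≠ 0 := by positivity
      refine ⟨∑ i, (w i / k) • v i, mem_convexHull_range_iff.2 ⟨fun i => w i / k,
        fun i => div_nonneg (hw i) (Nat.cast_nonneg k), ?_, rfl⟩, ?_⟩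
      · rw [← Finset.sum_div, hwk, div_self hk']
      · simp [Finset.smul_sum, smul_smul, mul_div_cancel₀ _ hk']

namespace IsBoxSystem

variable {ι B : Type*} [Fintype ι] {d : ℕ} {v : ι → Fin d → ℝ} {b : B → ι → ℝ} {h : B → ℕ}

theorem isFullLatticePolytope (H : IsBoxSystem v b h) :
    IsFullLatticePolytope (convexHull ℝ (Set.range v)) := by
  classical
  refine ⟨⟨Finset.univ.image v, ?_, by simp⟩, ?_⟩
  · intro x hx
    obtain ⟨i, rfl⟩ : ∃ i, v i = x := by simpa using hx
    exact H.vertex_mem i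
  · have hind : AffineIndependent ℝ v := by
      rw [affineIndependent_iff_of_fintype]
      intro w hw hv i
      rw [Finset.univ.weightedVSub_eq_linear_combination hw] at hv
      exact congrFun (H.eq_zero w hw hv) i
    rw [affineSpan_convexHull, hind.affineSpan_eq_top_iff_card_eq_finrank_add_one, H.card_eq]
    simp

theorem eq_of_sum_eq (H : IsBoxSystem v b h) {w w' : ι → ℝ} (h1 : ∑ i, w i = ∑ i, w' i)
    (h2 : ∑ i, w i • v i = ∑ i, w' i • v i) : w = w' := by
  have := H.eq_zero (w - w') (by simp [h1]) (by simp [sub_smul, h2])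
  exact sub_eq_zero.1 this

/-- Splitting off integer parts: a lattice point of `k P` has barycentric coordinates `b c + a` for
a unique box point `b c` and a unique `a ∈ ℕ^ι`, subject to `h c + ∑ i, a i = k`. -/
theorem latticePointCount_eq [Fintype B] [DecidableEq ι] (H : IsBoxSystem v b h) (k : ℕ) :
    latticePointCount ((k : ℝ) • convexHull ℝ (Set.range v)) =
      ∑ c, if h c ≤ k then ((Finset.univ : Finset ι).finsuppAntidiag (k - h c)).card else 0 := by
  have hne : Nonempty ι := Fintype.card_pos_iff.1 (by rw [H.card_eq]; omega)
  let s : Finset (Σ _ : B, ι →₀ ℕ) := Finset.univ.sigma fun c =>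
    if h c ≤ k then (Finset.univ : Finset ι).finsuppAntidiag (k - h c) else ∅
  have hs : ∀ p : Σ _ : B, ι →₀ ℕ, p ∈ s ↔ h p.1 + ∑ i, p.2 i = k := by
    rintro ⟨c, a⟩
    simp only [s, Finset.mem_sigma, Finset.mem_univ, true_and]
    split_ifs with hc
    · simp only [Finset.mem_finsuppAntidiag, Finset.subset_univ, and_true]
      change ∑ i, a i = k - h c ↔ _
      omega
    · simp only [Finset.notMem_empty, false_iff]
      omega
  let f : (Σ _ : B, ι →₀ ℕ) → Fin d → ℝ := fun p => ∑ i, (b p.1 i + (p.2 i : ℝ)) • v i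
  have hsum : ∀ p ∈ s, ∑ i, (b p.1 i + (p.2 i : ℝ)) = k := by
    intro p hp
    rw [Finset.sum_add_distrib, H.sum_eq, ← (hs p).1 hp]
    push_cast
    rfl
  have hinj : Set.InjOn f (s : Set (Σ _ : B, ι →₀ ℕ)) := by
    rintro ⟨c, a⟩ hp ⟨c', a'⟩ hp' hf
    have hw := H.eq_of_sum_eq ((hsum _ hp).trans (hsum _ hp').symm) hf
    have hb : b c = b c' := by
      funext i
      have hi := congrArg Int.fract (congrFun hw i)
      simpa [Int.fract_eq_self.2 ⟨H.nonneg c i, H.lt_one c i⟩,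
        Int.fract_eq_self.2 ⟨H.nonneg c' i, H.lt_one c' i⟩] using hi
    obtain rfl := H.injective hb
    have ha : a = a' := by
      ext i
      simpa using congrFun hw i
    rw [ha]
  have himg : ((k : ℝ) • convexHull ℝ (Set.range v)) ∩ integerLattice d =
      f '' (s : Set (Σ _ : B, ι →₀ ℕ)) := by
    ext x
    constructor
    · rintro ⟨hx, hxl⟩
      obtain ⟨w, hw, hwk, rfl⟩ := (mem_natCast_smul_convexHull_range_iff k).1 hx
      obtain ⟨c, hc⟩ := (H.integral_iff w).1 ⟨hwk ▸ natCast_mem_integralReals k, hxl⟩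
      have hn : ∀ i, ∃ n : ℕ, w i = b c i + n := by
        intro i
        obtain ⟨n, hn⟩ := mem_integralReals.1 (hc i)
        have h0 : (-1 : ℝ) < n := by linarith [hw i, H.lt_one c i]
        have h0' : -1 < n := by exact_mod_cast h0
        lift n to ℕ using by omega
        exact ⟨n, by push_cast at hn; linarith⟩
      choose a ha using hn
      have hfe : ∀ i, Finsupp.equivFunOnFinite.symm a i = a i := fun i => rfl
      refine ⟨⟨c, Finsupp.equivFunOnFinite.symm a⟩, (hs _).2 ?_, ?_⟩
      · simp only [hfe]
        have : ((h c + ∑ i, a i : ℕ) : ℝ) = k := by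
          push_cast
          rw [← hwk, ← H.sum_eq, ← Finset.sum_add_distrib]
          exact Finset.sum_congr rfl fun i _ => (ha i).symm
        exact_mod_cast this
      · simp only [f, hfe, ha]
    · rintro ⟨p, hp, rfl⟩
      refine ⟨(mem_natCast_smul_convexHull_range_iff k).2 ⟨_, fun i => ?_, hsum p hp, rfl⟩, ?_⟩
      · exact add_nonneg (H.nonneg _ _) (Nat.cast_nonneg _)
      · refine ((H.integral_iff _).2 ⟨p.1, fun i => ?_⟩).2
        rw [add_sub_cancel_left]
        exact natCast_mem_integralReals _
  rw [latticePointCount, himg, hinj.ncard_image, Set.ncard_coe_finset, Finset.card_sigma]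
  refine Finset.sum_congr rfl fun c _ => ?_
  split_ifs <;> simp

theorem ehrhartSeries_eq [Fintype B] (H : IsBoxSystem v b h) :
    ehrhartSeries (convexHull ℝ (Set.range v)) =
      (∑ c, PowerSeries.X ^ h c) * ((1 - PowerSeries.X) ^ (d + 1))⁻¹ := by
  classical
  have hinv : ((1 - PowerSeries.X : PowerSeries ℚ) ^ (d + 1))⁻¹ =
      ∏ _i : ι, (PowerSeries.mk 1 : PowerSeries ℚ) := by
    rw [eq_comm, PowerSeries.eq_inv_iff_mul_eq_one (by simp), Finset.prod_const,
      Finset.card_univ, H.card_eq, ← mul_pow, PowerSeries.mk_one_mul_one_sub_eq_one, one_pow]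
  ext k
  rw [hinv, Finset.sum_mul, map_sum, ehrhartSeries, PowerSeries.coeff_mk,
    H.latticePointCount_eq k]
  push_cast
  refine Finset.sum_congr rfl fun c _ => ?_
  rw [PowerSeries.coeff_X_pow_mul', PowerSeries.coeff_prod]
  simp

end IsBoxSystem

/-! ### Joins -/

/-- The point `(x, y, t)` of `ℝ^(p+q+1)`. -/
abbrev joinPoint {p q : ℕ} (x : Fin p → ℝ) (y : Fin q → ℝ) (t : ℝ) : Fin (p + q + 1) → ℝ :=
  Fin.snoc (α := fun _ => ℝ) (Fin.append x y) t

/-- The vertices `(v i, 0, 0)` and `(w j, 0, 1)` of the join of the simplices with vertices `v i`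
and `w j`. -/
def joinVertex {ι κ : Type*} {p q : ℕ} (v : ι → Fin p → ℝ) (w : κ → Fin q → ℝ) :
    ι ⊕ κ → Fin (p + q + 1) → ℝ :=
  Sum.elim (fun i => joinPoint (v i) 0 0) fun j => joinPoint 0 (w j) 1

theorem joinPoint_mem_integerLattice_iff {p q : ℕ} {x : Fin p → ℝ} {y : Fin q → ℝ} {t : ℝ} :
    joinPoint x y t ∈ integerLattice (p + q + 1) ↔
      x ∈ integerLattice p ∧ y ∈ integerLattice q ∧ t ∈ integralReals := by
  simp only [mem_integerLattice_iff]
  constructor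
  · intro hx
    refine ⟨fun i => ?_, fun j => ?_, ?_⟩
    · simpa only [Fin.snoc_castSucc, Fin.append_left] using hx (Fin.castSucc (Fin.castAdd q i))
    · simpa only [Fin.snoc_castSucc, Fin.append_right] using hx (Fin.castSucc (Fin.natAdd p j))
    · simpa only [Fin.snoc_last] using hx (Fin.last _)
  · rintro ⟨hx, hy, ht⟩ j
    refine Fin.lastCases ?_ (fun j => Fin.addCases (fun i => ?_) (fun i => ?_) j) j
    · simpa only [Fin.snoc_last] using ht
    · simpa only [Fin.snoc_castSucc, Fin.append_left] using hx i
    · simpa only [Fin.snoc_castSucc, Fin.append_right] using hy i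

theorem joinPoint_eq_zero_iff {p q : ℕ} {x : Fin p → ℝ} {y : Fin q → ℝ} {t : ℝ} :
    joinPoint x y t = 0 ↔ x = 0 ∧ y = 0 ∧ t = 0 := by
  constructor
  · intro hx
    refine ⟨funext fun i => ?_, funext fun j => ?_, ?_⟩
    · simpa only [Fin.snoc_castSucc, Fin.append_left, Pi.zero_apply] using
        congrFun hx (Fin.castSucc (Fin.castAdd q i))
    · simpa only [Fin.snoc_castSucc, Fin.append_right, Pi.zero_apply] using
        congrFun hx (Fin.castSucc (Fin.natAdd p j))
    · simpa only [Fin.snoc_last, Pi.zero_apply] using congrFun hx (Fin.last _)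
  · rintro ⟨rfl, rfl, rfl⟩
    funext j
    refine Fin.lastCases ?_ (fun j => Fin.addCases (fun i => ?_) (fun i => ?_) j) j
    · simp only [Fin.snoc_last, Pi.zero_apply]
    · simp only [Fin.snoc_castSucc, Fin.append_left, Pi.zero_apply]
    · simp only [Fin.snoc_castSucc, Fin.append_right, Pi.zero_apply]

theorem sum_smul_joinVertex {ι κ : Type*} [Fintype ι] [Fintype κ] {p q : ℕ}
    (v : ι → Fin p → ℝ) (w : κ → Fin q → ℝ) (u : ι ⊕ κ → ℝ) :
    ∑ x, u x • joinVertex v w x =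
      joinPoint (∑ i, u (.inl i) • v i) (∑ j, u (.inr j) • w j) (∑ j, u (.inr j)) := by
  rw [Fintype.sum_sum_type]
  funext j
  refine Fin.lastCases ?_ (fun j => Fin.addCases (fun i => ?_) (fun i => ?_) j) j
  · simp [joinVertex]
  · simp [joinVertex]
  · simp only [joinVertex, Pi.add_apply, Finset.sum_apply, Pi.smul_apply, Sum.elim_inl,
      Sum.elim_inr, Fin.snoc_castSucc, Fin.append_right, Pi.zero_apply, smul_zero,
      Finset.sum_const_zero, zero_add]

theorem polytopeJoin_convexHull_range {ι κ : Type*} [Fintype ι] [Fintype κ] {p q : ℕ}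
    (v : ι → Fin p → ℝ) (w : κ → Fin q → ℝ) :
    polytopeJoin (convexHull ℝ (Set.range v)) (convexHull ℝ (Set.range w)) =
      convexHull ℝ (Set.range (joinVertex v w)) := by
  apply Set.Subset.antisymm
  · refine convexHull_min ?_ (convex_convexHull ℝ _)
    rintro _ (⟨x, hx, rfl⟩ | ⟨y, hy, rfl⟩)
    · obtain ⟨a, ha, ha1, rfl⟩ := mem_convexHull_range_iff.1 hx
      refine mem_convexHull_range_iff.2 ⟨Sum.elim a 0, ?_, by simp [ha1], ?_⟩
      · rintro (i | j)
        exacts [ha i, le_rfl]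
      · rw [sum_smul_joinVertex]
        simp
    · obtain ⟨a, ha, ha1, rfl⟩ := mem_convexHull_range_iff.1 hy
      refine mem_convexHull_range_iff.2 ⟨Sum.elim 0 a, ?_, by simp [ha1], ?_⟩
      · rintro (i | j)
        exacts [le_rfl, ha j]
      · rw [sum_smul_joinVertex]
        simp [ha1]
  · refine convexHull_mono ?_
    rintro _ ⟨i | j, rfl⟩
    · exact Or.inl ⟨v i, subset_convexHull ℝ _ ⟨i, rfl⟩, rfl⟩
    · exact Or.inr ⟨w j, subset_convexHull ℝ _ ⟨j, rfl⟩, rfl⟩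

/-- A join has width one in the direction of its last coordinate. -/
theorem interior_polytopeJoin_inter_integerLattice {p q : ℕ} (P : Set (Fin p → ℝ))
    (Q : Set (Fin q → ℝ)) :
    interior (polytopeJoin P Q) ∩ integerLattice (p + q + 1) = ∅ := by
  let f : (Fin (p + q + 1) → ℝ) → ℝ := Function.eval (Fin.last (p + q))
  have hsub : polytopeJoin P Q ⊆ f ⁻¹' Set.Icc 0 1 := by
    refine convexHull_min ?_ ((convex_Icc (0 : ℝ) 1).linear_preimage
      (LinearMap.proj (R := ℝ) (φ := fun _ => ℝ) (Fin.last (p + q))))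
    rintro _ (⟨x, -, rfl⟩ | ⟨y, -, rfl⟩) <;> simp [f]
  rw [Set.eq_empty_iff_forall_notMem]
  rintro x ⟨hx, hxl⟩
  have hx' := interior_mono hsub hx
  rw [← (isOpenMap_eval _).preimage_interior_eq_interior_preimage (continuous_apply _),
    interior_Icc] at hx'
  obtain ⟨n, hn⟩ := hxl (Fin.last (p + q))
  obtain ⟨h0, h1⟩ : 0 < x (Fin.last (p + q)) ∧ x (Fin.last (p + q)) < 1 := hx'
  rw [hn] at h0 h1
  have h0' : 0 < n := by exact_mod_cast h0
  have h1' : n < 1 := by exact_mod_cast h1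
  omega

/-- The box points of a join are the pairs of box points of the factors, and heights add up: the
`h^*`-polynomial of a join is the product of those of the factors. -/
theorem IsBoxSystem.join {ι κ B C : Type*} [Fintype ι] [Fintype κ] {p q : ℕ}
    {v : ι → Fin p → ℝ} {w : κ → Fin q → ℝ} {b : B → ι → ℝ} {c : C → κ → ℝ} {h : B → ℕ}
    {g : C → ℕ} (H : IsBoxSystem v b h) (G : IsBoxSystem w c g) :
    IsBoxSystem (joinVertex v w) (fun e : B × C => Sum.elim (b e.1) (c e.2))
      (fun e => h e.1 + g e.2) where
  card_eq := by
    rw [Fintype.card_sum, H.card_eq, G.card_eq]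
    ring
  vertex_mem := by
    rintro (i | j)
    · exact joinPoint_mem_integerLattice_iff.2
        ⟨H.vertex_mem i, fun _ => ⟨0, by simp⟩, zero_mem _⟩
    · exact joinPoint_mem_integerLattice_iff.2
        ⟨fun _ => ⟨0, by simp⟩, G.vertex_mem j, mem_integralReals.2 ⟨1, by simp⟩⟩
  eq_zero := by
    intro u hu hv
    rw [sum_smul_joinVertex, joinPoint_eq_zero_iff] at hv
    rw [Fintype.sum_sum_type, hv.2.2, add_zero] at hu
    have h1 := H.eq_zero _ hu hv.1
    have h2 := G.eq_zero _ hv.2.2 hv.2.1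
    funext x
    rcases x with i | j
    exacts [congrFun h1 i, congrFun h2 j]
  nonneg := by
    rintro e (i | j)
    exacts [H.nonneg _ i, G.nonneg _ j]
  lt_one := by
    rintro e (i | j)
    exacts [H.lt_one _ i, G.lt_one _ j]
  injective := by
    rintro ⟨e1, e2⟩ ⟨f1, f2⟩ hef
    have h1 : b e1 = b f1 := funext fun i => congrFun hef (.inl i)
    have h2 : c e2 = c f2 := funext fun j => congrFun hef (.inr j)
    rw [H.injective h1, G.injective h2]
  sum_eq := by
    intro e
    rw [Fintype.sum_sum_type]
    push_cast
    exact congrArg₂ (· + ·) (H.sum_eq _) (G.sum_eq _)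
  integral_iff := by
    intro u
    rw [sum_smul_joinVertex, joinPoint_mem_integerLattice_iff, Fintype.sum_sum_type]
    constructor
    · rintro ⟨hs, h1, h2, h3⟩
      obtain ⟨e, he⟩ := (H.integral_iff _).1 ⟨(add_mem_cancel_right h3).1 hs, h1⟩
      obtain ⟨f, hf⟩ := (G.integral_iff _).1 ⟨h3, h2⟩
      refine ⟨(e, f), ?_⟩
      rintro (i | j)
      exacts [he i, hf j]
    · rintro ⟨e, he⟩
      obtain ⟨h1, h2⟩ := (H.integral_iff fun i => u (.inl i)).2 ⟨e.1, fun i => he (.inl i)⟩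
      obtain ⟨h3, h4⟩ := (G.integral_iff fun j => u (.inr j)).2 ⟨e.2, fun j => he (.inr j)⟩
      exact ⟨add_mem h1 h3, h2, h4, h3⟩

/-! ### Simplices with cyclic box group -/

/-- Suppose that the vectors of barycentric coordinates with integral height and integral value are
those congruent modulo `ℤ^ι` to `t • ε`, where `t` is an integral multiple of `1 / m` and `ε` is a
fixed integral vector with last entry `1`. Then the box points are the fractional parts of
`(c / m) • ε`, for `0 ≤ c < m`; here all of them except the origin have the same height `k`. -/
theorem IsBoxSystem.of_cyclic {d m k : ℕ} (hm : 1 ≤ m) {v : Fin (d + 1) → Fin d → ℝ}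
    {ε : Fin (d + 1) → ℤ} (hε : ε (Fin.last d) = 1)
    (hv : ∀ w : Fin (d + 1) → ℝ,
      (∑ i, w i ∈ integralReals ∧ ∑ i, w i • v i ∈ integerLattice d) ↔
        w (Fin.last d) * m ∈ integralReals ∧
          ∀ i, w i - ε i * w (Fin.last d) ∈ integralReals)
    (hk : ∀ t : ℝ, 0 < t → t < 1 → ∑ i, Int.fract (ε i * t) = k) :
    IsBoxSystem v (fun (c : Fin m) i => Int.fract (ε i * ((c : ℝ) / m)))
      (fun c => if (c : ℕ) = 0 then 0 else k) := by
  have hm0 : (0 : ℝ) < m := by exact_mod_cast hm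
  have hlt : ∀ c : Fin m, (c : ℝ) / m < 1 := fun c => by
    rw [div_lt_one hm0]
    exact_mod_cast c.2
  have hfract : ∀ x : ℝ, x - Int.fract x ∈ integralReals := fun x => by
    rw [Int.self_sub_fract]
    exact intCast_mem_integralReals _
  -- A real number all of whose real multiples are integral vanishes.
  have hzero : ∀ x : ℝ, (∀ t : ℝ, t * x ∈ integralReals) → x = 0 := by
    intro x hx
    by_contra h0
    obtain ⟨n, hn⟩ := mem_integralReals.1 (hx (1 / (2 * x)))
    rw [one_div, mul_inv, mul_assoc, inv_mul_cancel₀ h0, mul_one] at hn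
    have : (2 * n : ℤ) = 1 := by
      have : (2 * n : ℝ) = 1 := by linarith
      exact_mod_cast this
    omega
  refine ⟨by simp, fun i => ?_, fun w h1 h2 => ?_, fun c i => Int.fract_nonneg _,
    fun c i => Int.fract_lt_one _, fun c c' h => ?_, fun c => ?_, fun w => ?_⟩
  · have hint : ∀ j, (Pi.single i 1 : Fin (d + 1) → ℝ) j ∈ integralReals := by
      intro j
      rw [Pi.single_apply]
      split_ifs
      exacts [mem_integralReals.2 ⟨1, by simp⟩, zero_mem _]
    have h := ((hv (Pi.single i 1)).2 ⟨?_, fun j => ?_⟩).2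
    · simpa [Pi.single_apply] using h
    · rw [mul_comm, ← nsmul_eq_mul]
      exact nsmul_mem (hint _) _
    · rw [← zsmul_eq_mul]
      exact sub_mem (hint _) (zsmul_mem (hint _) _)
  · have hsc : ∀ t : ℝ, _ := fun t => (hv (t • w)).1 ⟨by simp [← Finset.mul_sum, h1], by
      simp only [Pi.smul_apply, smul_assoc, ← Finset.smul_sum, h2, smul_zero]
      exact fun _ => ⟨0, by simp⟩⟩
    have hlast : w (Fin.last d) = 0 := by
      have := hzero (w (Fin.last d) * m) fun t => by
        simpa [mul_assoc] using (hsc t).1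
      exact (mul_eq_zero.1 this).resolve_right hm0.ne'
    funext i
    exact hzero (w i) fun t => by simpa [hlast] using (hsc t).2 i
  · have h := congrFun h (Fin.last d)
    simp only [hε, Int.cast_one, one_mul] at h
    rw [Int.fract_eq_self.2 ⟨by positivity, hlt c⟩, Int.fract_eq_self.2 ⟨by positivity, hlt c'⟩,
      div_left_inj' hm0.ne'] at h
    exact Fin.ext (by exact_mod_cast h)
  · split_ifs with hc
    · simp [hc]
    · have : (0 : ℝ) < (c : ℕ) := by exact_mod_cast Nat.pos_of_ne_zero hc
      exact hk _ (by positivity) (hlt c)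
  · rw [hv]
    constructor
    · rintro ⟨h1, h2⟩
      obtain ⟨n, hn⟩ := mem_integralReals.1 h1
      have hmz : (0 : ℤ) < m := by exact_mod_cast hm
      have hc0 := Int.emod_nonneg n hmz.ne'
      have hcm := Int.emod_lt_of_pos n hmz
      refine ⟨⟨(n % m).toNat, by omega⟩, fun i => ?_⟩
      have hcast : (((n % m).toNat : ℕ) : ℝ) = ((n % m : ℤ) : ℝ) := by
        exact_mod_cast congrArg (Int.cast : ℤ → ℝ) (Int.toNat_of_nonneg hc0)
      -- Subtracting the residue `n % m` from `n = m w_d` leaves an integral multiple of `m`.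
      have hlast : w (Fin.last d) - ((n % m : ℤ) : ℝ) / m ∈ integralReals := by
        refine mem_integralReals.2 ⟨n / m, ?_⟩
        have hdm : ((n % m : ℤ) : ℝ) + m * ((n / m : ℤ) : ℝ) = n := by
          exact_mod_cast Int.emod_add_mul_ediv n m
        rw [eq_comm, ← mul_left_inj' hm0.ne', sub_mul, div_mul_cancel₀ _ hm0.ne', hn, ← hdm]
        ring
      have h3 := add_mem (h2 i) (zsmul_mem hlast (ε i))
      have h4 := add_mem h3 (hfract (ε i * (((n % m : ℤ) : ℝ) / m)))
      rw [zsmul_eq_mul] at h4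
      rw [hcast]
      convert h4 using 1
      ring
    · rintro ⟨c, hc⟩
      have h1 : ∀ i, w i - ε i * ((c : ℝ) / m) ∈ integralReals := fun i => by
        convert sub_mem (hc i) (hfract (ε i * ((c : ℝ) / m))) using 1
        ring
      have h2 := h1 (Fin.last d)
      rw [hε, Int.cast_one, one_mul] at h2
      refine ⟨?_, fun i => ?_⟩
      · convert add_mem (nsmul_mem h2 m) (natCast_mem_integralReals c) using 1
        rw [nsmul_eq_mul]
        field_simp
        ring
      · convert sub_mem (h1 i) (zsmul_mem h2 (ε i)) using 1
        rw [zsmul_eq_mul]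
        ring

theorem sum_pow_ite_eq {R : Type*} [CommRing R] (x : R) (l k : ℕ) :
    ∑ c : Fin (l + 1), x ^ (if (c : ℕ) = 0 then 0 else k) = 1 + l * x ^ k := by
  rw [Fin.sum_univ_succ]
  simp

theorem exists_eq_comp_val {n : ℕ} (w : Fin n → ℝ) : ∃ f : ℕ → ℝ, w = fun i : Fin n => f i :=
  ⟨fun i => if h : i < n then w ⟨i, h⟩ else 0, by simp⟩

theorem fract_neg_of_pos_of_lt_one {t : ℝ} (h0 : 0 < t) (h1 : t < 1) :
    Int.fract (-t) = 1 - t := by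
  rw [Int.fract_eq_iff]
  exact ⟨by linarith, by linarith, -1, by push_cast; ring⟩

/-! ### The simplex `S` -/

/-- The vertices `0, e_1, …, e_{d-1}, m e_d` of `S_d^{(m)}`. -/
noncomputable def vertexS (d m : ℕ) (i : Fin (d + 1)) : Fin d → ℝ :=
  (if (i : ℕ) = d then (m : ℝ) else 1) • unitVec d i

theorem unitVec_zero (d : ℕ) : unitVec d 0 = 0 := by
  funext j
  simp [unitVec]

theorem simplexS_eq_convexHull_range {d : ℕ} (hd : 1 ≤ d) (m : ℕ) :
    simplexS d m = convexHull ℝ (Set.range (vertexS d m)) := by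
  unfold simplexS
  congr 1
  apply Set.Subset.antisymm
  · rintro _ ((rfl | ⟨i, hi1, hid, rfl⟩) | rfl)
    · exact ⟨0, by simp [vertexS, unitVec_zero]⟩
    · exact ⟨⟨i, by omega⟩, by simp [vertexS, hid.ne]⟩
    · exact ⟨Fin.last d, by simp [vertexS]⟩
  · rintro _ ⟨i, rfl⟩
    by_cases hid : (i : ℕ) = d
    · exact Or.inr (by simp [vertexS, hid])
    · by_cases hi0 : (i : ℕ) = 0
      · exact Or.inl (Or.inl (by simp [vertexS, hi0, unitVec_zero]))
      · exact Or.inl (Or.inr ⟨i, by omega, by omega, by simp [vertexS, hid]⟩)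

theorem vertexS_apply (d m : ℕ) (i : Fin (d + 1)) (j : Fin d) :
    vertexS d m i j = (if (i : ℕ) = d then (m : ℝ) else 1) * (if (j : ℕ) + 1 = i then 1 else 0) :=
  rfl

theorem sum_smul_vertexS_apply (d m : ℕ) (f : ℕ → ℝ) (j : Fin d) :
    (∑ i : Fin (d + 1), f i • vertexS d m i) j =
      f (j + 1) * (if (j : ℕ) + 1 = d then (m : ℝ) else 1) := by
  rw [Finset.sum_apply, Finset.sum_eq_single j.succ]
  · simp [vertexS_apply]
  · intro i _ hi
    have : ¬ ((j : ℕ) + 1 = i) := fun h => hi (Fin.ext (by simp [← h]))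
    simp [vertexS_apply, this]
  · simp

theorem isBoxSystem_vertexS {d m : ℕ} (hd : 1 ≤ d) (hm : 1 ≤ m) :
    IsBoxSystem (vertexS d m)
      (fun (c : Fin m) (i : Fin (d + 1)) => Int.fract
        (((if (i : ℕ) = d then 1 else if (i : ℕ) = 0 then -1 else 0 : ℤ) : ℝ) * ((c : ℝ) / m)))
      (fun c => if (c : ℕ) = 0 then 0 else 1) := by
  obtain ⟨e, rfl⟩ : ∃ e, d = e + 1 := ⟨d - 1, by omega⟩
  have hsum : ∀ g : ℕ → ℝ, ∑ i : Fin (e + 1 + 1), g i =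
      (∑ i ∈ Finset.range e, g (i + 1)) + g 0 + g (e + 1) := fun g => by
    rw [Fin.sum_univ_eq_sum_range, Finset.sum_range_succ, Finset.sum_range_succ']
  refine IsBoxSystem.of_cyclic hm
    (ε := fun i => if (i : ℕ) = e + 1 then 1 else if (i : ℕ) = 0 then -1 else 0)
    (by simp) (fun w => ?_) (fun t h0 h1 => ?_)
  · obtain ⟨f, rfl⟩ := exists_eq_comp_val w
    rw [mem_integerLattice_iff, hsum]
    simp only [sum_smul_vertexS_apply, Fin.val_last]
    constructor
    · rintro ⟨h1, h2⟩
      have h3 : ∀ i < e, f (i + 1) ∈ integralReals := fun i hi => by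
        simpa [hi.ne] using h2 ⟨i, by omega⟩
      rw [add_assoc] at h1
      refine ⟨by simpa using h2 (Fin.last e), fun i => ?_⟩
      split_ifs with hi hi0
      · simp [hi, zero_mem]
      · have h4 := (add_mem_cancel_left
          (sum_mem fun i hi => h3 i (Finset.mem_range.1 hi))).1 h1
        simpa [hi0] using h4
      · have := h3 (i - 1) (by omega)
        rw [Nat.sub_add_cancel (by omega)] at this
        simpa using this
    · rintro ⟨h1, h2⟩
      have h3 : ∀ i < e, f (i + 1) ∈ integralReals := fun i hi => by
        simpa [hi.ne] using h2 ⟨i + 1, by omega⟩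
      have h4 : f 0 + f (e + 1) ∈ integralReals := by simpa using h2 0
      refine ⟨?_, fun j => ?_⟩
      · rw [add_assoc]
        exact add_mem (sum_mem fun i hi => h3 i (Finset.mem_range.1 hi)) h4
      · split_ifs with hj
        · rw [hj]
          exact h1
        · rw [mul_one]
          exact h3 _ (by omega)
  · rw [hsum fun i => Int.fract (((if i = e + 1 then 1 else if i = 0 then -1 else 0 : ℤ) : ℝ) * t),
      Finset.sum_eq_zero fun i hi => by
        simp [(Finset.mem_range.1 hi).ne]]
    simp [fract_neg_of_pos_of_lt_one h0 h1, Int.fract_eq_self.2 ⟨h0.le, h1⟩]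

/-! ### The simplex `T` -/

/-- The vertices `0, e_1, e_1 + e_2, …, e_{d-2} + e_{d-1}, e_{d-1} + m e_d` of `T_d^{(m)}`. -/
noncomputable def vertexT (d m : ℕ) (i : Fin (d + 1)) : Fin d → ℝ :=
  unitVec d (i - 1) + vertexS d m i

theorem simplexT_eq_convexHull_range {d : ℕ} (hd : 1 ≤ d) (m : ℕ) :
    simplexT d m = convexHull ℝ (Set.range (vertexT d m)) := by
  unfold simplexT
  congr 1
  apply Set.Subset.antisymm
  · rintro _ ((rfl | ⟨i, hi1, hid, rfl⟩) | rfl)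
    · exact ⟨0, by simp [vertexT, vertexS, unitVec_zero]⟩
    · exact ⟨⟨i, by omega⟩, by simp [vertexT, vertexS, hid.ne]⟩
    · exact ⟨Fin.last d, by simp [vertexT, vertexS]⟩
  · rintro _ ⟨i, rfl⟩
    by_cases hid : (i : ℕ) = d
    · exact Or.inr (by simp [vertexT, vertexS, hid])
    · by_cases hi0 : (i : ℕ) = 0
      · exact Or.inl (Or.inl (by simp [vertexT, vertexS, hi0, unitVec_zero]))
      · exact Or.inl (Or.inr ⟨i, by omega, by omega, by simp [vertexT, vertexS, hid]⟩)

theorem sum_smul_vertexT_apply (d m : ℕ) (f : ℕ → ℝ) (j : Fin d) :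
    (∑ i : Fin (d + 1), f i • vertexT d m i) j =
      (if (j : ℕ) + 1 < d then f (j + 2) else 0) +
        f (j + 1) * (if (j : ℕ) + 1 = d then (m : ℝ) else 1) := by
  simp only [vertexT, smul_add, Finset.sum_add_distrib]
  rw [Pi.add_apply, sum_smul_vertexS_apply, Finset.sum_apply]
  congr 1
  split_ifs with hj
  · rw [Finset.sum_eq_single ⟨j + 2, by omega⟩]
    · simp [unitVec]
    · intro i _ hi
      have : ¬ ((j : ℕ) + 1 = i - 1) := fun h => hi (Fin.ext (by simp; omega))
      simp [unitVec, this]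
    · simp
  · refine Finset.sum_eq_zero fun i _ => ?_
    have : ¬ ((j : ℕ) + 1 = i - 1) := by omega
    simp [unitVec, this]

theorem sum_range_two_mul (n : ℕ) (f : ℕ → ℝ) :
    ∑ i ∈ Finset.range (2 * n), f i = ∑ k ∈ Finset.range n, (f (2 * k) + f (2 * k + 1)) := by
  induction n with
  | zero => simp
  | succ n ih =>
    rw [Nat.mul_succ, Finset.sum_range_succ, Finset.sum_range_succ, ih, Finset.sum_range_succ,
      add_assoc]

/-- Integrality at `T_d^{(m)}` says that neighbouring coordinates have integral sums, so that modulo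
`ℤ` they alternate between `t` and `-t`. As `d` is odd, the `d + 1` coordinates of a box point form
`(d + 1) / 2` pairs with sum `1`. -/
theorem isBoxSystem_vertexT {d m : ℕ} (hd : Odd d) (hm : 1 ≤ m) :
    IsBoxSystem (vertexT d m)
      (fun (c : Fin m) (i : Fin (d + 1)) =>
        Int.fract ((((-1) ^ ((i : ℕ) + 1) : ℤ) : ℝ) * ((c : ℝ) / m)))
      (fun c => if (c : ℕ) = 0 then 0 else (d + 1) / 2) := by
  obtain ⟨r, rfl⟩ := hd
  have hsum : ∀ g : ℕ → ℝ, ∑ i : Fin (2 * r + 1 + 1), g i =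
      ∑ k ∈ Finset.range (r + 1), (g (2 * k) + g (2 * k + 1)) := fun g => by
    rw [Fin.sum_univ_eq_sum_range, ← sum_range_two_mul]
    rfl
  refine IsBoxSystem.of_cyclic hm (ε := fun i => (-1) ^ ((i : ℕ) + 1))
    (by simp [pow_succ, pow_mul]) (fun w => ?_) (fun t h0 h1 => ?_)
  · obtain ⟨f, rfl⟩ := exists_eq_comp_val w
    rw [mem_integerLattice_iff, hsum]
    simp only [sum_smul_vertexT_apply, Fin.val_last]
    constructor
    · rintro ⟨h1, h2⟩
      have h3 : ∀ i < 2 * r, f (i + 1) + f (i + 2) ∈ integralReals := fun i hi => by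
        have h := h2 ⟨i, by omega⟩
        rw [if_pos (by simpa using hi), if_neg (by simpa using hi.ne), mul_one, add_comm] at h
        exact h
      have h4 : f 0 + f 1 ∈ integralReals := by
        rw [Finset.sum_range_succ'] at h1
        exact (add_mem_cancel_left (sum_mem fun k hk => h3 (2 * k + 1)
          (by have := Finset.mem_range.1 hk; omega))).1 h1
      have h5 : ∀ i < 2 * r + 1, f i + f (i + 1) ∈ integralReals := by
        rintro (_ | i) hi
        exacts [h4, h3 i (by omega)]
      have h6 : ∀ n i, i + n = 2 * r + 1 →
          f i - (-1) ^ (i + 1) * f (2 * r + 1) ∈ integralReals := by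
        intro n
        induction n with
        | zero =>
          rintro i rfl
          simp [pow_succ, pow_mul, zero_mem]
        | succ n ih =>
          intro i hi
          convert sub_mem (h5 i (by omega)) (ih (i + 1) (by omega)) using 1
          ring
      refine ⟨by simpa using h2 (Fin.last (2 * r)), fun i => ?_⟩
      push_cast
      exact h6 (2 * r + 1 - i) i (by omega)
    · rintro ⟨h1, h2⟩
      have h3 : ∀ i < 2 * r + 1, f i + f (i + 1) ∈ integralReals := by
        intro i hi
        have h4 := h2 ⟨i, by omega⟩
        have h5 := h2 ⟨i + 1, by omega⟩
        push_cast at h4 h5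
        convert add_mem h4 h5 using 1
        ring
      refine ⟨sum_mem fun k hk => h3 _ (by have := Finset.mem_range.1 hk; omega), fun j => ?_⟩
      split_ifs with hj hj' hj'
      · omega
      · rw [mul_one, add_comm]
        exact h3 _ hj
      · rw [hj', zero_add]
        exact h1
      · omega
  · rw [hsum fun i => Int.fract ((((-1) ^ (i + 1) : ℤ) : ℝ) * t), Finset.sum_congr rfl
      (g := fun _ => (1 : ℝ)) fun k _ => by
        simp [pow_succ, pow_mul, fract_neg_of_pos_of_lt_one h0 h1,
          Int.fract_eq_self.2 ⟨h0.le, h1⟩]]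
    have : (2 * r + 1 + 1) / 2 = r + 1 := by omega
    simp [this]

/-! ### The join of `T` and `S` -/

theorem polytopeJoin_simplexT_simplexS {p q l m : ℕ} (hp : 1 ≤ p) (hq : Odd q) :
    IsFullLatticePolytope (polytopeJoin (simplexT q (l + 1)) (simplexS p (m + 1))) ∧
      ehrhartSeries (polytopeJoin (simplexT q (l + 1)) (simplexS p (m + 1))) =
        (1 + (m : PowerSeries ℚ) * PowerSeries.X
            + (l : PowerSeries ℚ) * PowerSeries.X ^ ((q + 1) / 2)
            + (m : PowerSeries ℚ) * (l : PowerSeries ℚ) * PowerSeries.X ^ ((q + 3) / 2)) *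
          ((1 - PowerSeries.X) ^ (p + q + 2))⁻¹ := by
  have H := (isBoxSystem_vertexT hq (Nat.le_add_left 1 l)).join
    (isBoxSystem_vertexS hp (Nat.le_add_left 1 m))
  rw [simplexT_eq_convexHull_range hq.pos, simplexS_eq_convexHull_range hp,
    polytopeJoin_convexHull_range]
  refine ⟨H.isFullLatticePolytope, ?_⟩
  rw [H.ehrhartSeries_eq]
  have h1 : (q + 3) / 2 = (q + 1) / 2 + 1 := by omega
  have h2 : q + p + 1 + 1 = p + q + 2 := by ring
  have h3 : ∑ e : Fin (l + 1) × Fin (m + 1), (PowerSeries.X : PowerSeries ℚ) ^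
      ((if (e.1 : ℕ) = 0 then 0 else (q + 1) / 2) + if (e.2 : ℕ) = 0 then 0 else 1) =
      (1 + (l : PowerSeries ℚ) * PowerSeries.X ^ ((q + 1) / 2)) *
        (1 + (m : PowerSeries ℚ) * PowerSeries.X ^ 1) := by
    rw [← sum_pow_ite_eq, ← sum_pow_ite_eq, Finset.sum_mul_sum, Fintype.sum_prod_type]
    exact Finset.sum_congr rfl fun _ _ => Finset.sum_congr rfl fun _ _ => pow_add _ _ _
  rw [h1, h2, h3]
  ring

open Polynomial in
/-- If `q ≥ 3`, then the coefficient `l` of `z^((q + 1) / 2)`, the last one below the leading term,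
is compared with the linear coefficient `m`. -/
theorem not_hibiLowerBound {p q l m : ℕ} (hp : 1 ≤ p) (hq : Odd q) (hq3 : 3 ≤ q) (hl : 1 ≤ l)
    (hlm : l < m) :
    ¬ HibiLowerBound (polytopeJoin (simplexT q (l + 1)) (simplexS p (m + 1))) := by
  intro hH
  obtain ⟨r, rfl⟩ := hq
  have hr : 1 ≤ r := by omega
  let h : ℚ[X] := 1 + C (m : ℚ) * X + C (l : ℚ) * X ^ (r + 1) + C (m * l : ℚ) * X ^ (r + 2)
  have hcoeff : ∀ i, h.coeff i = (if i = 0 then 1 else 0) + (if i = 1 then (m : ℚ) else 0) +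
      (if i = r + 1 then (l : ℚ) else 0) + (if i = r + 2 then (m * l : ℚ) else 0) := by
    intro i
    simp only [h, coeff_add, coeff_C_mul, coeff_X_pow, coeff_X, coeff_one, mul_ite, mul_one,
      mul_zero, eq_comm (a := 1)]
  have hdeg : h.natDegree = r + 2 := by
    refine natDegree_eq_of_le_of_coeff_ne_zero ?_ ?_
    · rw [natDegree_le_iff_coeff_eq_zero]
      intro i hi
      rw [hcoeff]
      simp [show i ≠ 0 by omega, show i ≠ 1 by omega, show i ≠ r + 1 by omega,
        show i ≠ r + 2 by omega]
    · rw [hcoeff]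
      have hl0 : l ≠ 0 := by omega
      have hm0 : m ≠ 0 := by omega
      simp [hl0, hm0]
  have hstar : IsHStarPolynomial
      (polytopeJoin (simplexT (2 * r + 1) (l + 1)) (simplexS p (m + 1))) h := by
    refine ⟨by omega, ?_⟩
    rw [(polytopeJoin_simplexT_simplexS hp ⟨r, rfl⟩).2]
    have h1 : (2 * r + 1 + 1) / 2 = r + 1 := by omega
    have h2 : (2 * r + 1 + 3) / 2 = r + 2 := by omega
    have h3 : 2 * r + 1 + p + 1 + 1 = p + (2 * r + 1) + 2 := by ring
    rw [h1, h2, h3]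
    congr 1
    have hcast : ∀ n : ℕ, ((n : ℚ[X]) : PowerSeries ℚ) = n := fun n =>
      map_natCast Polynomial.coeToPowerSeries.ringHom n
    simp [h, hcast]
  have := hH h hstar (r + 1) (by omega) (by omega)
  rw [hcoeff, hcoeff] at this
  have hlm' : (l : ℚ) < m := by exact_mod_cast hlm
  simp [show r ≠ 0 by omega] at this
  omega

theorem mainTheorem4 :
    (∀ p q l m : ℕ, 1 ≤ p → Odd q →
      IsFullLatticePolytope (polytopeJoin (simplexT q (l + 1)) (simplexS p (m + 1))) ∧
      ehrhartSeries (polytopeJoin (simplexT q (l + 1)) (simplexS p (m + 1))) =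
        (1 + (m : PowerSeries ℚ) * PowerSeries.X
            + (l : PowerSeries ℚ) * PowerSeries.X ^ ((q + 1) / 2)
            + (m : PowerSeries ℚ) * (l : PowerSeries ℚ) * PowerSeries.X ^ ((q + 3) / 2)) *
          ((1 - PowerSeries.X) ^ (p + q + 2))⁻¹) ∧
    (∀ p q l m : ℕ, 1 ≤ p → Odd q → 3 ≤ q → 1 ≤ l → l < m →
      IsFullLatticePolytope (polytopeJoin (simplexT q (l + 1)) (simplexS p (m + 1))) ∧
      interior (polytopeJoin (simplexT q (l + 1)) (simplexS p (m + 1))) ∩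
        integerLattice (q + p + 1) = ∅ ∧
      ¬ HibiLowerBound (polytopeJoin (simplexT q (l + 1)) (simplexS p (m + 1)))) := by
  refine ⟨fun p q l m hp hq => polytopeJoin_simplexT_simplexS hp hq,
    fun p q l m hp hq hq3 hl hlm => ⟨(polytopeJoin_simplexT_simplexS hp hq).1,
      interior_polytopeJoin_inter_integerLattice _ _, not_hibiLowerBound hp hq hq3 hl hlm⟩⟩
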